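/- \textbf{Theorem (moderate deviation principle for quenched means).} Let $\xi=(\xi_n)_{n\ge 0}$ be a stationary and ergodic sequence with values in a measurable space $\Theta$, and let $\theta\mapsto\eta(\theta)$ be a measurable map (a probability kernel) from $\Theta$ to the probability distributions on $\mathbb N\times\mathbb R\times\mathbb R\times\cdots$, where $\mathbb N=\{0,1,2,\dots\}$. Given $\xi$, consider the branching random walk with environment $\xi$ in time: under the quenched law $\mathbb P_\xi$ (with expectation $\mathbb E_\xi$) the random vectors $X(u)=(N(u),L_1(u),L_2(u),\dots)$, indexed by the finite sequences $u$ of positive integers, are independent, and $X(u)$ has distribution $\eta(\xi_n)$ if $u$ has length $|u|=n$; the initial particle $\emptyset$ is at $S_\emptyset=0$, and a particle $u$ of generation $n$ located at $S_u$ is replaced by $N(u)$ particles $ui$, $1\le i\le N(u)$, of generation $n+1$, located at $S_{ui}=S_u+L_i(u)$. Let $\mathbb T_n$ be the set of particles of generation $n$ and $Z_n=\sum_{u\in\mathbb T_n}\delta_{S_u}$ the counting measure of their positions. Write $N=N(\emptyset)$, $L_i=L_i(\emptyset)$, $\mathbb E$ for the expectation with respect to the total law (the law of $\xi$ followed by $\mathbb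 P_\xi$), and $\pi_0=m_0(0)=\mathbb E_\xi N$. Assume that $0<\pi_0<\infty$ a.s., and that $$\operatorname*{ess\,sup}\ \frac1{\pi_0}\,\mathbb E_\xi\sum_{i=1}^N e^{\delta|L_i|}<\infty\ \text{ for some }\delta>0,\qquad \mathbb E_\xi\sum_{i=1}^N L_i=0\quad\text{a.s.}$$ Let $(a_n)$ be a sequence of positive numbers with $a_n/n\to0$ and $a_n/\sqrt n\to\infty$. Put $$\sigma^2=\mathbb E\Big[\frac1{\pi_0}\sum_{i=1}^N L_i^2\Big],\qquad I(x)=\frac{x^2}{2\sigma^2},$$ where, if $\sigma^2=0$, $I(0)=0$ and $I(x)=\infty$ for $x\ne0$. Then $\sigma^2<\infty$ and, for almost every $\xi$, the maps $$q_n(A)=\frac{\mathbb E_\xi Z_n(a_nA)}{\mathbb E_\xi Z_n(\mathbb R)}$$ are probability measures on $\mathbb R$ for all $n$ and satisfy, for every Borel set $A\subseteq\mathbb R$ with interior $A^o$ and closure $\bar A$, $$-\inf_{x\in A^o}I(x)\ \le\ \liminf_{n\to\infty}\frac{n}{a_n^2}\log q_n(A)\ \le\ \limsup_{n\to\infty}\frac{n}{a_n^2}\log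 q_n(A)\ \le\ -\inf_{x\in\bar A}I(x),$$ with $\log0=-\infty$ and $\inf\emptyset=+\infty$. -/

import Mathlib

open MeasureTheory ProbabilityTheory Filter Topology
open scoped ENNReal Pointwise

namespace BRWRE

/-- A mark `(N, L_1, L_2, …)`: the number of children of a particle and the displacements of its
children.  Children are numbered from `0`, so the relevant displacements are `L i` with `i < N`. -/
abbrev Mark : Type := ℕ × (ℕ → ℝ)

/-- Particles are labelled by finite sequences of naturals, the last letter first: `i :: u` is the
child number `i` of the particle `u`, `[]` is the initial particle, and the generation of `u` is
`u.length`. -/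
abbrev Label : Type := List ℕ

/-- A realisation of the family of marks `X(u)`, one for each label `u`. -/
abbrev Marks : Type := Label → Mark

/-- The time shift on environment sequences. -/
def shift {Θ : Type*} (ξ : ℕ → Θ) : ℕ → Θ := fun n => ξ (n + 1)

/-- The position `S_u` : `S_∅ = 0` and `S_{ui} = S_u + L_i(u)`. -/
def position (ω : Marks) : Label → ℝ
  | [] => 0
  | i :: u => position ω u + (ω u).2 i

/-- `u` belongs to the Galton–Watson tree: `∅` does, and `ui` does iff `u` does and `ui` is one of
the `N(u)` children of `u`. -/
def InTree (ω : Marks) : Label → Prop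
  | [] => True
  | i :: u => InTree ω u ∧ i < (ω u).1

/-- The particles of generation `n`. -/
def generation (n : ℕ) (ω : Marks) : Set Label := {u | InTree ω u ∧ u.length = n}

/-- The counting measure `Z_n = ∑_{u ∈ T_n} δ_{S_u}` of the particles of generation `n`. -/
noncomputable def Z (n : ℕ) (ω : Marks) : Measure ℝ :=
  Measure.sum fun u : generation n ω => Measure.dirac (position ω u)

section Quenched

variable {Θ : Type*} [MeasurableSpace Θ]

/-- The quenched law `P_ξ`: the marks `X(u)` are independent and `X(u)` has law `η(ξ_{|u|})`. -/
noncomputable def quenchedLaw (η : Kernel Θ Mark) [IsMarkovKernel η] (ξ : ℕ → Θ) :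
    Measure Marks :=
  Measure.infinitePi fun u : Label => η (ξ u.length)

/-- `E_ξ ∑_{i=1}^{N(u)} f(L_i(u))` for the particle `u = 11⋯1` of generation `n`, for nonnegative
`f`. -/
noncomputable def quenchedSum (η : Kernel Θ Mark) [IsMarkovKernel η] (ξ : ℕ → Θ) (n : ℕ)
    (f : ℝ → ℝ≥0∞) : ℝ≥0∞ :=
  ∫⁻ ω, ∑ i ∈ Finset.range (ω (List.replicate n 0)).1, f ((ω (List.replicate n 0)).2 i)
    ∂(quenchedLaw η ξ)

/-- `m_n(t) = E_ξ ∑_{i=1}^{N(u)} exp(t L_i(u))`, `|u| = n`. -/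
noncomputable def m (η : Kernel Θ Mark) [IsMarkovKernel η] (ξ : ℕ → Θ) (n : ℕ) (t : ℝ) : ℝ≥0∞ :=
  quenchedSum η ξ n fun x => ENNReal.ofReal (Real.exp (t * x))

/-- `σ² = E[π₀⁻¹ ∑_{i=1}^N L_i²]` with `π₀ = m_0(0)`; the annealed expectation is the integral over
the law `τ` of the environment of the quenched expectation. -/
noncomputable def sigmaSq (η : Kernel Θ Mark) [IsMarkovKernel η] (τ : Measure (ℕ → Θ)) : ℝ≥0∞ :=
  ∫⁻ ξ, (m η ξ 0 0)⁻¹ * quenchedSum η ξ 0 (fun x => ENNReal.ofReal (x ^ 2)) ∂τ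

/-- The quenched mean measure `E_ξ Z_n`. -/
noncomputable def meanZ (η : Kernel Θ Mark) [IsMarkovKernel η] (ξ : ℕ → Θ) (n : ℕ) : Measure ℝ :=
  (quenchedLaw η ξ).bind (Z n)

/-- The measure `A ↦ E_ξ Z_n(c A) / E_ξ Z_n(ℝ)`, for `c > 0`. -/
noncomputable def normalizedMean (η : Kernel Θ Mark) [IsMarkovKernel η] (ξ : ℕ → Θ) (n : ℕ)
    (c : ℝ) : Measure ℝ :=
  (meanZ η ξ n Set.univ)⁻¹ • (meanZ η ξ n).map (fun x => x / c)

end Quenched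

/-- The rate function `x ↦ x² / (2 s)`; if `s = 0`, it is `0` at `0` and `∞` elsewhere. -/
noncomputable def rate (s : ℝ≥0∞) (x : ℝ) : ℝ≥0∞ := ENNReal.ofReal (x ^ 2) / (2 * s)

theorem measurable_position (u : Label) : Measurable fun ω : Marks => position ω u := by
  induction u with
  | nil => exact measurable_const
  | cons i u ih =>
    have h : Measurable fun ω : Marks => (ω u).2 i :=
      (measurable_pi_apply i).comp (measurable_snd.comp (measurable_pi_apply u))
    exact ih.add h

theorem measurableSet_inTree (u : Label) : MeasurableSet {ω : Marks | InTree ω u} := by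
  induction u with
  | nil => simp [InTree]
  | cons i u ih =>
    have h : Measurable fun ω : Marks => (ω u).1 := measurable_fst.comp (measurable_pi_apply u)
    exact ih.inter (h measurableSet_Ioi)

theorem Z_apply (n : ℕ) (ω : Marks) {A : Set ℝ} (hA : MeasurableSet A) :
    Z n ω A = ∑' u : Label, Set.indicator {ω : Marks | InTree ω u ∧ u.length = n}
      (fun ω => A.indicator (fun _ => (1 : ℝ≥0∞)) (position ω u)) ω := by
  rw [Z, Measure.sum_apply _ hA,
    tsum_subtype (generation n ω) (fun u => (Measure.dirac (position ω u)) A)]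
  refine tsum_congr fun u => ?_
  by_cases h : InTree ω u ∧ u.length = n
  · rw [Set.indicator_of_mem (by exact h), Set.indicator_of_mem (by exact h),
      Measure.dirac_apply' _ hA]
    rfl
  · rw [Set.indicator_of_notMem (by exact h), Set.indicator_of_notMem (by exact h)]

theorem measurable_Z (n : ℕ) : Measurable (Z n) := by
  refine Measure.measurable_of_measurable_coe _ fun A hA => ?_
  simp only [Z_apply n _ hA]
  refine Measurable.tsum fun u => ?_
  refine Measurable.indicator ?_ ((measurableSet_inTree u).inter (MeasurableSet.const _))
  exact (measurable_const.indicator hA).comp (measurable_position u)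

theorem meanZ_apply {Θ : Type*} [MeasurableSpace Θ] (η : Kernel Θ Mark) [IsMarkovKernel η]
    (ξ : ℕ → Θ) (n : ℕ) {A : Set ℝ} (hA : MeasurableSet A) :
    meanZ η ξ n A = ∫⁻ ω, Z n ω A ∂(quenchedLaw η ξ) :=
  Measure.bind_apply hA (measurable_Z n).aemeasurable

theorem normalizedMean_apply {Θ : Type*} [MeasurableSpace Θ] (η : Kernel Θ Mark)
    [IsMarkovKernel η] (ξ : ℕ → Θ) (n : ℕ) {c : ℝ} (hc : 0 < c) {A : Set ℝ}
    (hA : MeasurableSet A) :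
    normalizedMean η ξ n c A =
      (∫⁻ ω, Z n ω (c • A) ∂(quenchedLaw η ξ)) / ∫⁻ ω, Z n ω Set.univ ∂(quenchedLaw η ξ) := by
  have hpre : (fun x : ℝ => x / c) ⁻¹' A = c • A := by
    ext x
    rw [Set.mem_smul_set_iff_inv_smul_mem₀ hc.ne', Set.mem_preimage, smul_eq_mul, div_eq_inv_mul]
  have hm : Measurable fun x : ℝ => x / c := measurable_id.div_const c
  have hcA : MeasurableSet (c • A) := hpre ▸ hm hA
  rw [← meanZ_apply η ξ n hcA, ← meanZ_apply η ξ n MeasurableSet.univ, normalizedMean,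
    Measure.smul_apply, Measure.map_apply hm hA, hpre, smul_eq_mul, ENNReal.div_eq_inv_mul]

end BRWRE

/-! Given the marks of the first `n` generations, the mark of a particle of generation `n` is still
distributed according to `η (ξ n)`, so the mean measures satisfy `E Z_{n+1} = E Z_n ∗ ν_n`, where
`ν_n` is the mean measure of the displacements of the children of such a particle. After
normalization, `E Z_n` is therefore the law of a random walk with independent centered steps in a
varying environment.

The exponential moment bound makes the expansion `t² / 2 * Var` of the cumulant generating functions
of the steps uniform in the environment, with an error `O(|t|³)`, and Birkhoff's ergodic theorem
gives the convergence of the averaged variances to `σ²`. Hence, at speed `a_n² / n`, the rescaled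
cumulant generating functions converge to `l² σ² / 2`. The Gärtner–Ellis argument then applies: the
Chernoff bound gives the upper estimate, and the lower one follows by tilting the walk exponentially
so that its mean moves to `l σ²`. For `σ² = 0` tilting does not move the mean, which is consistent
with the rate being infinite off `0`. -/

namespace BRWRE

open scoped NNReal

section Birkhoff

variable {α : Type*} {T : α → α} {f : α → ℝ}

/-- The running maximum `max (S_0, …, S_n)` of the Birkhoff sums of `f`, where `S_0 = 0`. -/
noncomputable def birkhoffMax (T : α → α) (f : α → ℝ) : ℕ →o (α → ℝ) :=
  partialSups (birkhoffSum T f)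

theorem birkhoffMax_zero : birkhoffMax T f 0 = 0 := by
  rw [birkhoffMax, partialSups_zero, birkhoffSum_zero']

theorem birkhoffSum_le_birkhoffMax (n : ℕ) : birkhoffSum T f n ≤ birkhoffMax T f n :=
  le_partialSups _ n

theorem birkhoffMax_nonneg (n : ℕ) : 0 ≤ birkhoffMax T f n :=
  birkhoffMax_zero.symm.trans_le ((birkhoffMax T f).mono n.zero_le)

theorem birkhoffMax_succ (n : ℕ) (x : α) :
    birkhoffMax T f (n + 1) x = max 0 (f x + birkhoffMax T f n (T x)) := by
  have hsucc (k : ℕ) (y : α) :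
      birkhoffMax T f (k + 1) y = max (birkhoffMax T f k y) (birkhoffSum T f (k + 1) y) :=
    congrFun (partialSups_add_one (birkhoffSum T f) k) y
  induction n with
  | zero => simp [hsucc, birkhoffMax_zero]
  | succ n ih =>
    rw [hsucc, ih, birkhoffSum_succ', max_assoc, max_add_add_left, hsucc n (T x)]

theorem birkhoffMax_succ_sub (n : ℕ) (x : α) :
    birkhoffMax T f (n + 1) x - birkhoffMax T f n (T x) =
      max (-birkhoffMax T f n (T x)) (f x) := by
  rw [birkhoffMax_succ, ← max_sub_sub_right, zero_sub, add_sub_cancel_right]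

theorem bddAbove_range_birkhoffSum_comp (x : α) :
    BddAbove (Set.range fun n => birkhoffSum T f n (T x)) ↔
      BddAbove (Set.range fun n => birkhoffSum T f n x) := by
  constructor
  · rintro ⟨B, hB⟩
    refine ⟨max 0 (f x + B), ?_⟩
    rintro _ ⟨_ | n, rfl⟩
    · exact le_max_left _ _
    · dsimp only
      rw [birkhoffSum_succ']
      exact le_max_of_le_right (add_le_add_right (hB ⟨n, rfl⟩) _)
  · rintro ⟨B, hB⟩
    refine ⟨B - f x, ?_⟩
    rintro _ ⟨n, rfl⟩
    rw [le_sub_iff_add_le', ← birkhoffSum_succ']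
    exact hB ⟨n + 1, rfl⟩

theorem tendsto_birkhoffMax_atTop {x : α}
    (hx : ¬ BddAbove (Set.range fun n => birkhoffSum T f n x)) :
    Tendsto (fun n => birkhoffMax T f n x) atTop atTop :=
  tendsto_atTop_atTop_of_monotone' (fun _ _ hmn => (birkhoffMax T f).mono hmn x) fun ⟨B, hB⟩ =>
    hx ⟨B, by
      rintro _ ⟨n, rfl⟩
      exact (birkhoffSum_le_birkhoffMax n x).trans (hB ⟨n, rfl⟩)⟩

variable [MeasurableSpace α] {μ : Measure α}

theorem measurable_birkhoffSum (hT : Measurable T) (hf : Measurable f) (n : ℕ) :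
    Measurable (birkhoffSum T f n) :=
  Finset.measurable_fun_sum _ fun k _ => hf.comp (hT.iterate k)

theorem integrable_birkhoffMax (hT : MeasurePreserving T μ μ) (hf : Integrable f μ) (n : ℕ) :
    Integrable (birkhoffMax T f n) μ := by
  induction n with
  | zero => exact birkhoffMax_zero (T := T) (f := f) ▸ integrable_zero _ _ _
  | succ n ih =>
    rw [funext (birkhoffMax_succ n)]
    exact (integrable_zero _ _ _).sup (hf.add (hT.integrable_comp_of_integrable ih))

/-- `∫ M_n ∘ T = ∫ M_n ≤ ∫ M_{n+1}`, so the increment `M_{n+1} - M_n ∘ T` has nonnegative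
integral. -/
theorem integral_max_neg_birkhoffMax_nonneg (hT : MeasurePreserving T μ μ) (hf : Integrable f μ)
    (n : ℕ) : 0 ≤ ∫ x, max (-birkhoffMax T f n (T x)) (f x) ∂μ := by
  have hM := integrable_birkhoffMax hT hf
  have hMT : Integrable (fun x => birkhoffMax T f n (T x)) μ :=
    hT.integrable_comp_of_integrable (hM n)
  have hinv : ∫ x, birkhoffMax T f n (T x) ∂μ = ∫ x, birkhoffMax T f n x ∂μ := by
    rw [← integral_map hT.aemeasurable (by rw [hT.map_eq]; exact (hM n).aestronglyMeasurable),
      hT.map_eq]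
  simp only [← birkhoffMax_succ_sub]
  rw [integral_sub (hM (n + 1)) hMT, hinv]
  exact sub_nonneg.2 (integral_mono (hM n) (hM (n + 1)) ((birkhoffMax T f).mono n.le_succ))

theorem tendsto_integral_max_neg_birkhoffMax (hT : MeasurePreserving T μ μ) (hf : Integrable f μ)
    (hunb : ∀ᵐ x ∂μ, ¬ BddAbove (Set.range fun n => birkhoffSum T f n x)) :
    Tendsto (fun n => ∫ x, max (-birkhoffMax T f n (T x)) (f x) ∂μ) atTop (𝓝 (∫ x, f x ∂μ)) := by
  have hint (n : ℕ) : Integrable (fun x => max (-birkhoffMax T f n (T x)) (f x)) μ :=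
    (hT.integrable_comp_of_integrable (integrable_birkhoffMax hT hf n)).neg.sup hf
  refine tendsto_integral_of_dominated_convergence (fun x => |f x|)
    (fun n => (hint n).aestronglyMeasurable) hf.abs (fun n => ae_of_all _ fun x => ?_) ?_
  · rw [Real.norm_eq_abs, abs_le]
    exact ⟨(neg_abs_le _).trans (le_max_right _ _),
      max_le ((neg_nonpos.2 (birkhoffMax_nonneg n (T x))).trans (abs_nonneg _)) (le_abs_self _)⟩
  · filter_upwards [hunb] with x hx
    refine tendsto_const_nhds.congr' ?_
    filter_upwards [(tendsto_birkhoffMax_atTop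
      (mt (bddAbove_range_birkhoffSum_comp x).1 hx)).eventually_ge_atTop (-f x)] with n hn
    exact (max_eq_right (neg_le.1 hn)).symm

theorem ae_bddAbove_range_birkhoffSum (hT : Ergodic T μ) (hfm : Measurable f)
    (hf : Integrable f μ) (hneg : ∫ x, f x ∂μ < 0) :
    ∀ᵐ x ∂μ, BddAbove (Set.range fun n => birkhoffSum T f n x) := by
  have hmeas : MeasurableSet {x | BddAbove (Set.range fun n => birkhoffSum T f n x)} :=
    measurableSet_bddAbove_range (measurable_birkhoffSum hT.measurable hfm)
  refine (hT.toPreErgodic.ae_mem_or_ae_notMem hmeas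
    (Set.ext bddAbove_range_birkhoffSum_comp)).resolve_right fun hunb => hneg.not_ge ?_
  exact ge_of_tendsto' (tendsto_integral_max_neg_birkhoffMax hT.toMeasurePreserving hf hunb)
    (integral_max_neg_birkhoffMax_nonneg hT.toMeasurePreserving hf)

variable [IsProbabilityMeasure μ]

theorem ae_eventually_birkhoffAverage_le (hT : Ergodic T μ) (hfm : Measurable f)
    (hf : Integrable f μ) {c : ℝ} (hc : ∫ x, f x ∂μ < c) :
    ∀ᵐ x ∂μ, ∀ᶠ n : ℕ in atTop, birkhoffAverage ℝ T f n x ≤ c := by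
  obtain ⟨d, hd, hdc⟩ := exists_between hc
  have hneg : ∫ x, (f x - d) ∂μ < 0 := by
    rw [integral_sub hf (integrable_const _), integral_const, probReal_univ, one_smul]
    exact sub_neg.2 hd
  filter_upwards [ae_bddAbove_range_birkhoffSum hT (hfm.sub_const d)
    (hf.sub (integrable_const _)) hneg] with x ⟨B, hB⟩
  filter_upwards [(tendsto_natCast_atTop_atTop (R := ℝ)).eventually_ge_atTop (B / (c - d)),
    eventually_gt_atTop 0] with n hnB hn
  have hsum : birkhoffSum T f n x - n * d ≤ B := by
    simpa [birkhoffSum, Finset.sum_sub_distrib] using hB ⟨n, rfl⟩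
  rw [div_le_iff₀ (sub_pos.2 hdc)] at hnB
  rw [birkhoffAverage, smul_eq_mul, inv_mul_le_iff₀ (by positivity)]
  linarith

theorem ae_tendsto_birkhoffAverage (hT : Ergodic T μ) (hfm : Measurable f)
    (hf : Integrable f μ) :
    ∀ᵐ x ∂μ, Tendsto (birkhoffAverage ℝ T f · x) atTop (𝓝 (∫ x, f x ∂μ)) := by
  have hupper (g : α → ℝ) (hgm : Measurable g) (hg : Integrable g μ) : ∀ᵐ x ∂μ, ∀ j : ℕ,
      ∀ᶠ n in atTop, birkhoffAverage ℝ T g n x ≤ ∫ x, g x ∂μ + 1 / ((j : ℝ) + 1) :=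
    ae_all_iff.2 fun j => ae_eventually_birkhoffAverage_le hT hgm hg
      (lt_add_of_pos_right _ Nat.one_div_pos_of_nat)
  filter_upwards [hupper f hfm hf, hupper (-f) hfm.neg hf.neg] with x hf_le hneg_le
  rw [Metric.tendsto_nhds]
  intro ε hε
  obtain ⟨j, hj⟩ := exists_nat_one_div_lt hε
  filter_upwards [hf_le j, hneg_le j] with n hn hn_neg
  simp only [birkhoffAverage_neg, Pi.neg_apply, integral_neg] at hn_neg
  rw [Real.dist_eq, abs_lt]
  constructor <;> linarith

end Birkhoff

section LargeDeviations

/-- The large deviation principle for the measures `p n` at speed `b n` with rate function `I`: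
`p n A` decays like `exp (-b n * ⨅ x ∈ A, I x)`, up to the usual topological corrections.  The
logarithm is the `EReal`-valued one, with `log 0 = ⊥`. -/
structure HasLDP {X : Type*} [TopologicalSpace X] [MeasurableSpace X] (p : ℕ → Measure X)
    (b : ℕ → ℝ) (I : X → ℝ≥0∞) : Prop where
  le_liminf (G : Set X) : IsOpen G → -((⨅ x ∈ G, I x : ℝ≥0∞) : EReal) ≤
    liminf (fun n => (((b n)⁻¹ : ℝ) : EReal) * ENNReal.log (p n G)) atTop
  limsup_le (F : Set X) : IsClosed F →
    limsup (fun n => (((b n)⁻¹ : ℝ) : EReal) * ENNReal.log (p n F)) atTop ≤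
      -((⨅ x ∈ F, I x : ℝ≥0∞) : EReal)

section
variable {X : Type*} [TopologicalSpace X] [MeasurableSpace X] {p : ℕ → Measure X} {b : ℕ → ℝ}
  {I : X → ℝ≥0∞}

theorem inv_mul_log_mono {c : ℝ} (hc : 0 ≤ c) :
    Monotone fun q => ((c⁻¹ : ℝ) : EReal) * ENNReal.log q :=
  fun _ _ h => mul_le_mul_of_nonneg_left (ENNReal.log_monotone h)
    (EReal.coe_nonneg.2 (inv_nonneg.2 hc))

theorem HasLDP.le_liminf_interior (h : HasLDP p b I) (hb : ∀ᶠ n in atTop, 0 ≤ b n) (A : Set X) :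
    -((⨅ x ∈ interior A, I x : ℝ≥0∞) : EReal) ≤
      liminf (fun n => (((b n)⁻¹ : ℝ) : EReal) * ENNReal.log (p n A)) atTop :=
  (h.le_liminf _ isOpen_interior).trans <| liminf_le_liminf <| hb.mono fun _ hn =>
    inv_mul_log_mono hn (measure_mono interior_subset)

theorem HasLDP.limsup_le_closure (h : HasLDP p b I) (hb : ∀ᶠ n in atTop, 0 ≤ b n) (A : Set X) :
    limsup (fun n => (((b n)⁻¹ : ℝ) : EReal) * ENNReal.log (p n A)) atTop ≤
      -((⨅ x ∈ closure A, I x : ℝ≥0∞) : EReal) :=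
  le_trans (limsup_le_limsup <| hb.mono fun _ hn =>
    inv_mul_log_mono hn (measure_mono subset_closure)) (h.limsup_le _ isClosed_closure)

end

theorem inv_mul_log_ofReal_exp {b : ℝ} (hb : 0 < b) (c : ℝ) :
    ((b⁻¹ : ℝ) : EReal) * ENNReal.log (ENNReal.ofReal (Real.exp (-(b * c)))) = -(c : EReal) := by
  rw [ENNReal.log_ofReal_of_pos (Real.exp_pos _), Real.log_exp, ← EReal.coe_mul, ← EReal.coe_neg,
    mul_neg, inv_mul_cancel_left₀ hb.ne']

theorem limsup_inv_mul_log_le {b : ℕ → ℝ} (hb : Tendsto b atTop atTop) {q : ℕ → ℝ≥0∞} {J : EReal}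
    (h : ∀ c : ℝ, (c : EReal) < J →
      ∀ᶠ n in atTop, q n ≤ ENNReal.ofReal (Real.exp (-(b n * c)))) :
    limsup (fun n => (((b n)⁻¹ : ℝ) : EReal) * ENNReal.log (q n)) atTop ≤ -J := by
  rw [EReal.le_neg]
  refine EReal.ge_of_forall_gt_iff_ge.1 fun c hc => ?_
  rw [EReal.le_neg]
  refine limsup_le_of_le (by isBoundedDefault) ?_
  filter_upwards [h c hc, hb.eventually_gt_atTop 0] with n hn hbn
  exact (inv_mul_log_mono hbn.le hn).trans_eq (inv_mul_log_ofReal_exp hbn c)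

theorem le_liminf_inv_mul_log {b : ℕ → ℝ} (hb : Tendsto b atTop atTop) {q : ℕ → ℝ≥0∞} {J : EReal}
    (h : ∀ c : ℝ, J < c → ∀ᶠ n in atTop, ENNReal.ofReal (Real.exp (-(b n * c))) ≤ q n) :
    -J ≤ liminf (fun n => (((b n)⁻¹ : ℝ) : EReal) * ENNReal.log (q n)) atTop := by
  rw [EReal.neg_le]
  refine EReal.le_of_forall_lt_iff_le.1 fun c hc => ?_
  rw [EReal.neg_le]
  refine le_liminf_of_le (by isBoundedDefault) ?_
  filter_upwards [h c hc, hb.eventually_gt_atTop 0] with n hn hbn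
  exact (inv_mul_log_ofReal_exp hbn c).symm.trans_le (inv_mul_log_mono hbn.le hn)

end LargeDeviations

section GaussianRate

variable {s : ℝ≥0} {x c : ℝ}

theorem rate_abs (s : ℝ≥0∞) (x : ℝ) : rate s |x| = rate s x := by
  rw [rate, rate, sq_abs]

theorem rate_zero_left (hx : x ≠ 0) : rate 0 x = ∞ := by
  rw [rate, mul_zero]
  exact ENNReal.div_zero (ENNReal.ofReal_pos.2 (sq_pos_of_ne_zero hx)).ne'

theorem rate_mul_coe (l : ℝ) (s : ℝ≥0) : rate s (l * s) = ENNReal.ofReal (l ^ 2 * s / 2) := by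
  rcases eq_or_ne s 0 with rfl | hs
  · simp [rate]
  have : 0 < (s : ℝ) := by positivity
  rw [rate, ← ENNReal.ofReal_coe_nnreal, ← ENNReal.ofReal_ofNat, ← ENNReal.ofReal_mul zero_le_two,
    ← ENNReal.ofReal_div_of_pos (by positivity)]
  congr 1
  field_simp

theorem exists_mul_coe_eq_of_rate_ne_top (h : rate s x ≠ ∞) : ∃ l : ℝ, l * s = x := by
  rcases eq_or_ne s 0 with rfl | hs
  · exact ⟨0, by_contra fun hx => h (rate_zero_left (by simpa [eq_comm] using hx))⟩
  · exact ⟨x / s, div_mul_cancel₀ _ (by exact_mod_cast hs)⟩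

/-- `rate s` is the Legendre transform of `k ↦ k ^ 2 * s / 2`. -/
theorem exists_lt_mul_sub_of_lt_rate (hx : 0 ≤ x) (h : (c : EReal) < rate s x) :
    ∃ k ≥ 0, c < k * x - k ^ 2 * s / 2 := by
  rcases eq_or_ne s 0 with rfl | hs
  · rcases hx.eq_or_lt with rfl | hx
    · exact ⟨0, le_rfl, by simpa [rate] using h⟩
    · obtain ⟨k, hk⟩ := exists_nat_gt (c / x)
      exact ⟨k, k.cast_nonneg, by simpa using (div_lt_iff₀ hx).1 hk⟩
  · have hs' : 0 < (s : ℝ) := by positivity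
    refine ⟨x / s, by positivity, ?_⟩
    rw [← div_mul_cancel₀ x hs'.ne', rate_mul_coe, EReal.coe_ennreal_ofReal,
      max_eq_left (by positivity), EReal.coe_lt_coe_iff] at h
    exact h.trans_eq (by field_simp; ring)

end GaussianRate

section GaussianCgfLimit

variable {Ω : Type*} [MeasurableSpace Ω]

/-- The hypothesis of the Gärtner–Ellis theorem with Gaussian limit of variance `s`: under `p n`,
the cumulant generating function of `b n * X n`, divided by the speed `b n`, converges to
`l ↦ l ^ 2 * s / 2`. -/
structure HasGaussianCgfLimit (X : ℕ → Ω → ℝ) (p : ℕ → Measure Ω) (b : ℕ → ℝ) (s : ℝ≥0) :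
    Prop where
  integrable_exp_mul (l : ℝ) :
    ∀ᶠ n in atTop, Integrable (fun ω => Real.exp (b n * l * X n ω)) (p n)
  tendsto_cgf (l : ℝ) :
    Tendsto (fun n => (b n)⁻¹ * cgf (X n) (p n) (b n * l)) atTop (𝓝 (l ^ 2 * s / 2))

variable {X : ℕ → Ω → ℝ} {p : ℕ → Measure Ω} {b : ℕ → ℝ} {s : ℝ≥0}

theorem integrable_exp_mul_tilted {μ : Measure Ω} {X : Ω → ℝ} {t u : ℝ}
    (ht : Integrable (fun ω => Real.exp (t * X ω)) μ)
    (htu : Integrable (fun ω => Real.exp ((t + u) * X ω)) μ) :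
    Integrable (fun ω => Real.exp (u * X ω)) (μ.tilted (t * X ·)) := by
  rw [integrable_tilted_iff ht]
  simpa only [smul_eq_mul, ← Real.exp_add, ← add_mul] using htu

theorem cgf_tilted {μ : Measure Ω} [NeZero μ] {X : Ω → ℝ} {t u : ℝ}
    (ht : Integrable (fun ω => Real.exp (t * X ω)) μ)
    (htu : Integrable (fun ω => Real.exp ((t + u) * X ω)) μ) :
    cgf X (μ.tilted (t * X ·)) u = cgf X μ (t + u) - cgf X μ t := by
  have hmgf : mgf X (μ.tilted (t * X ·)) u = mgf X μ (t + u) / mgf X μ t := by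
    simp only [mgf, integral_exp_tilted, Pi.add_apply, ← add_mul]
  rw [cgf, hmgf, Real.log_div (mgf_pos' (NeZero.ne μ) htu).ne' (mgf_pos' (NeZero.ne μ) ht).ne',
    cgf, cgf]

theorem cgf_sub_const {μ : Measure Ω} [NeZero μ] {X : Ω → ℝ} {t : ℝ}
    (ht : Integrable (fun ω => Real.exp (t * X ω)) μ) (c : ℝ) :
    cgf (fun ω => X ω - c) μ t = cgf X μ t - t * c := by
  have h := mgf_add_const (X := X) (μ := μ) (t := t) (-c)
  simp only [← sub_eq_add_neg] at h
  rw [cgf, h, Real.log_mul (mgf_pos' (NeZero.ne μ) ht).ne' (Real.exp_pos _).ne', Real.log_exp, cgf]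
  ring

/-- Exponential tilting by `b n * l * X n` moves the mean by `l * s` and preserves the Gaussian
limit, because `(l + k) ^ 2 * s / 2 - l ^ 2 * s / 2 - k * (l * s) = k ^ 2 * s / 2`. -/
theorem HasGaussianCgfLimit.tilted [∀ n, NeZero (p n)] (h : HasGaussianCgfLimit X p b s)
    (hb : ∀ᶠ n in atTop, b n ≠ 0) (l : ℝ) :
    HasGaussianCgfLimit (fun n ω => X n ω - l * s) (fun n => (p n).tilted (b n * l * X n ·)) b
      s where
  integrable_exp_mul k := by
    filter_upwards [h.integrable_exp_mul l, h.integrable_exp_mul (l + k)] with n hl hlk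
    simp only [mul_sub, Real.exp_sub]
    exact (integrable_exp_mul_tilted hl (by rwa [← mul_add])).div_const _
  tendsto_cgf k := by
    have hlim := ((h.tendsto_cgf (l + k)).sub (h.tendsto_cgf l)).sub_const (k * (l * s))
    rw [show (l + k) ^ 2 * s / 2 - l ^ 2 * s / 2 - k * (l * s) = k ^ 2 * s / 2 by ring] at hlim
    refine hlim.congr' ?_
    filter_upwards [h.integrable_exp_mul l, h.integrable_exp_mul (l + k), hb] with n hl hlk hbn
    rw [mul_add] at hlk
    have : NeZero ((p n).tilted (b n * l * X n ·)) :=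
      have := isProbabilityMeasure_tilted hl
      inferInstance
    rw [cgf_sub_const (integrable_exp_mul_tilted hl hlk), cgf_tilted hl hlk]
    field_simp

theorem HasGaussianCgfLimit.eventually_cgf_le (h : HasGaussianCgfLimit X p b s)
    (hb : Tendsto b atTop atTop) {l c : ℝ} (hc : l ^ 2 * s / 2 < c) :
    ∀ᶠ n in atTop, cgf (X n) (p n) (b n * l) ≤ b n * c := by
  filter_upwards [(h.tendsto_cgf l).eventually_lt_const hc, hb.eventually_gt_atTop 0] with n hn hbn
  exact ((inv_mul_lt_iff₀ hbn).1 hn).le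

theorem HasGaussianCgfLimit.eventually_le_cgf (h : HasGaussianCgfLimit X p b s)
    (hb : Tendsto b atTop atTop) {l c : ℝ} (hc : c < l ^ 2 * s / 2) :
    ∀ᶠ n in atTop, b n * c ≤ cgf (X n) (p n) (b n * l) := by
  filter_upwards [(h.tendsto_cgf l).eventually_const_lt hc, hb.eventually_gt_atTop 0] with n hn hbn
  exact ((lt_inv_mul_iff₀ hbn).1 hn).le

theorem HasGaussianCgfLimit.eventually_measureReal_le_abs_le [∀ n, IsFiniteMeasure (p n)]
    (h : HasGaussianCgfLimit X p b s) (hb : Tendsto b atTop atTop) {r c : ℝ} (hr : 0 ≤ r)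
    (hc : (c : EReal) < rate s r) :
    ∀ᶠ n in atTop, (p n).real {ω | r ≤ |X n ω|} ≤ Real.exp (-(b n * c)) := by
  obtain ⟨k, hk, hck⟩ := exists_lt_mul_sub_of_lt_rate hr hc
  obtain ⟨d, hcd, hdk⟩ := exists_between hck
  filter_upwards [h.integrable_exp_mul k, h.integrable_exp_mul (-k),
    h.eventually_cgf_le hb (l := k) (c := k * r - d) (by linarith),
    h.eventually_cgf_le hb (l := -k) (c := k * r - d) (by rw [neg_sq]; linarith),
    hb.eventually_ge_atTop (Real.log 2 / (d - c)), hb.eventually_ge_atTop 0]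
    with n hint hint' hcgf hcgf' hlog hbn
  have hupper : (p n).real {ω | r ≤ X n ω} ≤ Real.exp (-(b n * d)) :=
    (measure_ge_le_exp_cgf r (by positivity) hint).trans (Real.exp_le_exp.2 (by linarith))
  have hlower : (p n).real {ω | X n ω ≤ -r} ≤ Real.exp (-(b n * d)) :=
    (measure_le_le_exp_cgf (-r) (by nlinarith) hint').trans (Real.exp_le_exp.2 (by linarith))
  rw [div_le_iff₀ (sub_pos.2 hcd)] at hlog
  calc (p n).real {ω | r ≤ |X n ω|}
      ≤ (p n).real ({ω | r ≤ X n ω} ∪ {ω | X n ω ≤ -r}) :=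
        measureReal_mono fun ω (hω : r ≤ |X n ω|) => (le_abs.1 hω).imp_right le_neg_of_le_neg
    _ ≤ Real.exp (-(b n * d)) + Real.exp (-(b n * d)) :=
        (measureReal_union_le _ _).trans (add_le_add hupper hlower)
    _ = Real.exp (Real.log 2 - b n * d) := by
        rw [sub_eq_add_neg, Real.exp_add, Real.exp_log two_pos, two_mul]
    _ ≤ Real.exp (-(b n * c)) := Real.exp_le_exp.2 (by linarith)

theorem HasGaussianCgfLimit.eventually_half_le_tilted [∀ n, IsProbabilityMeasure (p n)]
    (h : HasGaussianCgfLimit X p b s) (hb : Tendsto b atTop atTop) (l : ℝ) {ε : ℝ} (hε : 0 < ε) :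
    ∀ᶠ n in atTop,
      1 / 2 ≤ ((p n).tilted (b n * l * X n ·)).real {ω | |X n ω - l * s| < ε} := by
  have hrate : 0 < rate s ε :=
    ENNReal.div_pos (ENNReal.ofReal_pos.2 (by positivity)).ne' (by finiteness)
  obtain ⟨c, hc, hcε⟩ := EReal.lt_iff_exists_real_btwn.1 (EReal.coe_ennreal_pos.2 hrate)
  have hc : 0 < c := EReal.coe_pos.1 hc
  filter_upwards [h.integrable_exp_mul l,
    (h.tilted (hb.eventually_ne_atTop 0) l).eventually_measureReal_le_abs_le hb hε.le hcε,
    hb.eventually_ge_atTop (Real.log 2 / c)] with n hint hn hlog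
  have := isProbabilityMeasure_tilted hint
  have hsmall : Real.exp (-(b n * c)) ≤ 1 / 2 := by
    rw [div_le_iff₀ hc] at hlog
    rw [one_div, ← Real.exp_log two_pos, ← Real.exp_neg]
    exact Real.exp_le_exp.2 (neg_le_neg hlog)
  have hcover := measureReal_union_le (μ := (p n).tilted (b n * l * X n ·))
    {ω | |X n ω - l * s| < ε} {ω | ε ≤ |X n ω - l * s|}
  have hunion : {ω | |X n ω - l * s| < ε} ∪ {ω | ε ≤ |X n ω - l * s|} = Set.univ :=
    Set.eq_univ_of_forall fun ω => lt_or_ge |X n ω - l * s| ε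
  rw [hunion, probReal_univ] at hcover
  linarith

theorem exp_cgf_sub_mul_measureReal_tilted_le {μ : Measure Ω} [IsFiniteMeasure μ] {X : Ω → ℝ}
    {t M : ℝ} (ht : Integrable (fun ω => Real.exp (t * X ω)) μ) {B : Set Ω}
    (hM : ∀ ω ∈ B, t * X ω ≤ M) :
    Real.exp (cgf X μ t - M) * (μ.tilted (t * X ·)).real B ≤ μ.real B := by
  have hle : μ.tilted (t * X ·) B ≤ ENNReal.ofReal (Real.exp (M - cgf X μ t)) * μ B := by
    rw [tilted_mul_apply_cgf B ht, ← setLIntegral_const]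
    refine setLIntegral_mono measurable_const fun ω hω => ENNReal.ofReal_le_ofReal ?_
    exact Real.exp_le_exp.2 (sub_le_sub_right (hM ω hω) _)
  have hreal := ENNReal.toReal_mono (by finiteness) hle
  rw [ENNReal.toReal_mul, ENNReal.toReal_ofReal (Real.exp_pos _).le] at hreal
  rw [← neg_sub, Real.exp_neg, inv_mul_le_iff₀ (Real.exp_pos _)]
  exact hreal

/-- Untilting costs at most `b n * (l ^ 2 * s + |l| * ε)` minus the cumulant generating function,
which is about `b n * (l ^ 2 * s / 2)`. -/
theorem HasGaussianCgfLimit.eventually_exp_le_measureReal [∀ n, IsProbabilityMeasure (p n)]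
    (h : HasGaussianCgfLimit X p b s) (hb : Tendsto b atTop atTop) {l ε c : ℝ} (hε : 0 < ε)
    (hc : l ^ 2 * s / 2 + |l| * ε < c) :
    ∀ᶠ n in atTop, Real.exp (-(b n * c)) ≤ (p n).real {ω | |X n ω - l * s| < ε} := by
  obtain ⟨d, hd, hdc⟩ := exists_between hc
  filter_upwards [h.integrable_exp_mul l, h.eventually_half_le_tilted hb l hε,
    h.eventually_le_cgf hb (l := l) (c := l ^ 2 * s + |l| * ε - d) (by linarith),
    hb.eventually_ge_atTop (Real.log 2 / (c - d)), hb.eventually_ge_atTop 0]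
    with n hint hhalf hcgf hlog hbn
  rw [div_le_iff₀ (sub_pos.2 hdc)] at hlog
  have hmax : ∀ ω ∈ {ω | |X n ω - l * s| < ε},
      b n * l * X n ω ≤ b n * (l ^ 2 * s + |l| * ε) := by
    intro ω (hω : |X n ω - l * s| < ε)
    have hdev : l * (X n ω - l * s) ≤ |l| * ε :=
      (le_abs_self _).trans (by rw [abs_mul]; gcongr)
    rw [mul_assoc]
    exact mul_le_mul_of_nonneg_left (by linarith) hbn
  calc Real.exp (-(b n * c))
      ≤ Real.exp (cgf (X n) (p n) (b n * l) - b n * (l ^ 2 * s + |l| * ε) - Real.log 2) :=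
        Real.exp_le_exp.2 (by linarith)
    _ = Real.exp (cgf (X n) (p n) (b n * l) - b n * (l ^ 2 * s + |l| * ε)) * (1 / 2) := by
        rw [Real.exp_sub _ (Real.log 2), Real.exp_log two_pos, div_eq_mul_one_div]
    _ ≤ _ := mul_le_mul_of_nonneg_left hhalf (Real.exp_pos _).le
    _ ≤ _ := exp_cgf_sub_mul_measureReal_tilted_le hint hmax

theorem HasGaussianCgfLimit.hasLDP [∀ n, IsProbabilityMeasure (p n)]
    (h : HasGaussianCgfLimit X p b s) (hb : Tendsto b atTop atTop) (hX : ∀ n, Measurable (X n)) :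
    HasLDP (fun n => (p n).map (X n)) b (rate s) where
  le_liminf G hG := by
    refine le_liminf_inv_mul_log hb fun c hc => ?_
    have hc0 : 0 ≤ c := EReal.coe_nonneg.1 ((EReal.coe_ennreal_nonneg _).trans hc.le)
    have hc' : ⨅ x ∈ G, rate s x < ENNReal.ofReal c := by
      rwa [← EReal.coe_ennreal_lt_coe_ennreal_iff, EReal.coe_ennreal_ofReal, max_eq_left hc0]
    obtain ⟨x, hxG, hxc⟩ := by simpa only [iInf_lt_iff] using hc'
    obtain ⟨l, rfl⟩ := exists_mul_coe_eq_of_rate_ne_top hxc.ne_top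
    rw [rate_mul_coe, ENNReal.ofReal_lt_ofReal_iff'] at hxc
    obtain ⟨r, hr, hrG⟩ := Metric.isOpen_iff.1 hG _ hxG
    have hlim : Tendsto (fun ε => l ^ 2 * s / 2 + |l| * ε) (𝓝 0) (𝓝 (l ^ 2 * s / 2)) :=
      Continuous.tendsto' (by fun_prop) 0 _ (by simp)
    obtain ⟨ε, hεc, hε, hεr⟩ := (((hlim.eventually_lt_const hxc.1).filter_mono
      nhdsWithin_le_nhds).and (Ioo_mem_nhdsGT hr)).exists
    filter_upwards [h.eventually_exp_le_measureReal hb hε hεc] with n hn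
    rw [Measure.map_apply (hX n) hG.measurableSet, ENNReal.ofReal_le_iff_le_toReal (by finiteness)]
    exact hn.trans (measureReal_mono fun ω hω => hrG (Metric.ball_subset_ball hεr.le hω))
  limsup_le F hF := by
    refine limsup_inv_mul_log_le hb fun c hc => ?_
    rcases F.eq_empty_or_nonempty with rfl | hne
    · simp
    obtain ⟨y, hyF, hy⟩ := hF.exists_infDist_eq_dist hne 0
    have hcy : (c : EReal) < rate s |y| := by
      rw [rate_abs]
      exact hc.trans_le (EReal.coe_ennreal_le_coe_ennreal_iff.2 (iInf₂_le y hyF))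
    filter_upwards [h.eventually_measureReal_le_abs_le hb (abs_nonneg y) hcy] with n hn
    rw [Measure.map_apply (hX n) hF.measurableSet, ENNReal.le_ofReal_iff_toReal_le (by finiteness)
      (Real.exp_pos _).le]
    refine (measureReal_mono fun ω (hω : X n ω ∈ F) => ?_).trans hn
    simpa [hy] using Metric.infDist_le_dist_of_mem (x := 0) hω

end GaussianCgfLimit

section CenteredStep

open scoped Nat

theorem abs_pow_le_exp {δ : ℝ} (hδ : 0 < δ) (n : ℕ) (x : ℝ) :
    |x| ^ n ≤ n ! / δ ^ n * Real.exp (δ * |x|) := by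
  have h := Real.pow_div_factorial_le_exp (x := δ * |x|) (by positivity) n
  rw [mul_pow, div_le_iff₀ (by positivity)] at h
  rw [div_mul_eq_mul_div, le_div_iff₀ (by positivity)]
  linarith

theorem integrable_pow_of_integrable_exp_abs {δ : ℝ} {μ : Measure ℝ} (hδ : 0 < δ)
    (h : Integrable (fun x => Real.exp (δ * |x|)) μ) (n : ℕ) : Integrable (fun x => x ^ n) μ := by
  refine (h.const_mul (n ! / δ ^ n)).mono' (by fun_prop) (ae_of_all _ fun x => ?_)
  rw [Real.norm_eq_abs, abs_pow]
  exact abs_pow_le_exp hδ n x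

theorem integrable_exp_abs_of_lintegral_ne_top {δ : ℝ} {μ : Measure ℝ}
    (h : ∫⁻ x, ENNReal.ofReal (Real.exp (δ * |x|)) ∂μ ≠ ∞) :
    Integrable (fun x => Real.exp (δ * |x|)) μ :=
  (lintegral_ofReal_ne_top_iff_integrable (by fun_prop)
    (ae_of_all _ fun _ => (Real.exp_pos _).le)).1 h

/-- Half of the exponent `δ` absorbs `|x| ^ 3`, the other half the exponential in the Taylor
remainder `|t * x| ^ 3 * exp |t * x|`; the constant is `3! * 2 ^ 3`. -/
theorem abs_exp_mul_sub_le {δ t : ℝ} (hδ : 0 < δ) (ht : |t| ≤ δ / 2) (x : ℝ) :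
    |Real.exp (t * x) - (1 + t * x + t ^ 2 / 2 * x ^ 2)| ≤
      48 / δ ^ 3 * |t| ^ 3 * Real.exp (δ * |x|) := by
  have htaylor : |Real.exp (t * x) - (1 + t * x + t ^ 2 / 2 * x ^ 2)| ≤
      |t * x| ^ 3 * Real.exp |t * x| := by
    have h := Complex.norm_exp_sub_sum_le_norm_mul_exp ((t * x : ℝ) : ℂ) 3
    rw [Complex.norm_real, Real.norm_eq_abs] at h
    refine le_trans (le_of_eq ?_) h
    rw [← Real.norm_eq_abs, ← Complex.norm_real]
    congr 1
    simp [Finset.sum_range_succ, Nat.factorial]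
    ring
  have hcube := abs_pow_le_exp (half_pos hδ) 3 x
  have hconst : ((3 ! : ℕ) : ℝ) / (δ / 2) ^ 3 = 48 / δ ^ 3 := by
    norm_num [Nat.factorial]
    field_simp
    norm_num
  rw [hconst] at hcube
  calc |Real.exp (t * x) - (1 + t * x + t ^ 2 / 2 * x ^ 2)|
      ≤ |t| ^ 3 * |x| ^ 3 * Real.exp (|t| * |x|) := by rwa [abs_mul, mul_pow] at htaylor
    _ ≤ |t| ^ 3 * (48 / δ ^ 3 * Real.exp (δ / 2 * |x|)) * Real.exp (δ / 2 * |x|) := by gcongr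
    _ = 48 / δ ^ 3 * |t| ^ 3 * Real.exp (δ * |x|) := by
      rw [show δ * |x| = δ / 2 * |x| + δ / 2 * |x| by ring, Real.exp_add]
      ring

theorem abs_log_one_add_sub_le {y : ℝ} (hy : |y| ≤ 1 / 2) : |Real.log (1 + y) - y| ≤ 2 * y ^ 2 := by
  have h := Real.abs_log_sub_add_sum_range_le (x := -y) (by rw [abs_neg]; linarith) 1
  rw [Finset.sum_range_one, abs_neg, sub_neg_eq_add, sq_abs] at h
  refine le_trans (le_of_eq (by norm_num [neg_add_eq_sub])) (h.trans ?_)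
  rw [div_le_iff₀ (by linarith)]
  nlinarith [mul_nonneg (sq_nonneg y) (sub_nonneg.2 hy)]

/-- A centered step distribution of a random walk, with a quantitative exponential moment. -/
structure IsCenteredStep (δ : ℝ) (C : ℝ≥0) (ν : Measure ℝ) : Prop where
  isProbabilityMeasure : IsProbabilityMeasure ν
  lintegral_exp_abs_le : ∫⁻ x, ENNReal.ofReal (Real.exp (δ * |x|)) ∂ν ≤ C
  integral_eq_zero : ∫ x, x ∂ν = 0

namespace IsCenteredStep

variable {δ t : ℝ} {C : ℝ≥0} {ν : Measure ℝ}

theorem integrable_exp_abs (h : IsCenteredStep δ C ν) :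
    Integrable (fun x => Real.exp (δ * |x|)) ν :=
  integrable_exp_abs_of_lintegral_ne_top (h.lintegral_exp_abs_le.trans_lt ENNReal.coe_lt_top).ne

theorem integral_exp_abs_le (h : IsCenteredStep δ C ν) : ∫ x, Real.exp (δ * |x|) ∂ν ≤ C := by
  rw [integral_eq_lintegral_of_nonneg_ae (ae_of_all _ fun _ => (Real.exp_pos _).le) (by fun_prop)]
  exact ENNReal.toReal_mono ENNReal.coe_ne_top h.lintegral_exp_abs_le

theorem integrable_exp_mul (h : IsCenteredStep δ C ν) (ht : |t| ≤ δ) :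
    Integrable (fun x => Real.exp (t * x)) ν := by
  refine h.integrable_exp_abs.mono' (by fun_prop) (ae_of_all _ fun x => ?_)
  rw [Real.norm_eq_abs, Real.abs_exp, Real.exp_le_exp]
  exact (le_abs_self _).trans (by rw [abs_mul]; gcongr)

theorem integrable_pow (h : IsCenteredStep δ C ν) (hδ : 0 < δ) (n : ℕ) :
    Integrable (fun x => x ^ n) ν :=
  integrable_pow_of_integrable_exp_abs hδ h.integrable_exp_abs n

theorem integral_sq_le (h : IsCenteredStep δ C ν) (hδ : 0 < δ) :
    ∫ x, x ^ 2 ∂ν ≤ 2 / δ ^ 2 * C := by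
  calc ∫ x, x ^ 2 ∂ν ≤ ∫ x, 2 / δ ^ 2 * Real.exp (δ * |x|) ∂ν :=
        integral_mono (h.integrable_pow hδ 2) (h.integrable_exp_abs.const_mul _) fun x => by
          simpa using abs_pow_le_exp hδ 2 x
    _ ≤ 2 / δ ^ 2 * C := by
        rw [integral_const_mul]
        exact mul_le_mul_of_nonneg_left h.integral_exp_abs_le (by positivity)

theorem abs_mgf_sub_le (h : IsCenteredStep δ C ν) (hδ : 0 < δ) (ht : |t| ≤ δ / 2) :
    |mgf id ν t - (1 + t ^ 2 / 2 * ∫ x, x ^ 2 ∂ν)| ≤ 48 / δ ^ 3 * C * |t| ^ 3 := by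
  have := h.isProbabilityMeasure
  have hid : Integrable (fun x : ℝ => x) ν := by simpa using h.integrable_pow hδ 1
  have hlin : Integrable (fun x => 1 + t * x) ν := (integrable_const _).add (hid.const_mul t)
  have hsq := (h.integrable_pow hδ 2).const_mul (t ^ 2 / 2)
  have hpoly : ∫ x, (1 + t * x + t ^ 2 / 2 * x ^ 2) ∂ν = 1 + t ^ 2 / 2 * ∫ x, x ^ 2 ∂ν := by
    rw [integral_add hlin hsq, integral_add (integrable_const _) (hid.const_mul t),
      integral_const_mul, integral_const_mul, h.integral_eq_zero]
    simp
  have hexp : Integrable (fun x => Real.exp (t * x)) ν := h.integrable_exp_mul (by linarith)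
  rw [← hpoly]
  calc _ = |∫ x, (Real.exp (t * x) - (1 + t * x + t ^ 2 / 2 * x ^ 2)) ∂ν| :=
        congrArg abs (integral_sub hexp (hlin.add hsq)).symm
    _ ≤ ∫ x, 48 / δ ^ 3 * |t| ^ 3 * Real.exp (δ * |x|) ∂ν := by
        rw [← Real.norm_eq_abs]
        exact norm_integral_le_of_norm_le (h.integrable_exp_abs.const_mul _)
          (ae_of_all _ fun x => abs_exp_mul_sub_le hδ ht x)
    _ ≤ 48 / δ ^ 3 * |t| ^ 3 * C := by
        rw [integral_const_mul]
        exact mul_le_mul_of_nonneg_left h.integral_exp_abs_le (by positivity)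
    _ = 48 / δ ^ 3 * C * |t| ^ 3 := by ring

theorem abs_mgf_sub_one_le (h : IsCenteredStep δ C ν) (hδ : 0 < δ) (ht : |t| ≤ δ / 2) :
    |mgf id ν t - 1| ≤ 25 * C / δ ^ 2 * t ^ 2 := by
  set V := ∫ x, x ^ 2 ∂ν
  have : 0 ≤ V := integral_nonneg fun x => sq_nonneg x
  calc |mgf id ν t - 1|
      = |mgf id ν t - (1 + t ^ 2 / 2 * V) + t ^ 2 / 2 * V| := by ring_nf
    _ ≤ |mgf id ν t - (1 + t ^ 2 / 2 * V)| + |t ^ 2 / 2 * V| := abs_add_le _ _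
    _ ≤ 48 / δ ^ 3 * C * (t ^ 2 * (δ / 2)) + t ^ 2 / 2 * (2 / δ ^ 2 * C) := by
        refine add_le_add ((h.abs_mgf_sub_le hδ ht).trans ?_) ?_
        · rw [pow_succ |t|, sq_abs]
          gcongr
        · rw [abs_of_nonneg (by positivity)]
          gcongr
          exact h.integral_sq_le hδ
    _ = 25 * C / δ ^ 2 * t ^ 2 := by field_simp; ring

theorem exists_abs_cgf_sub_le (hδ : 0 < δ) (C : ℝ≥0) :
    ∃ K, ∃ t₀ > 0, ∀ ν, IsCenteredStep δ C ν → ∀ t, |t| ≤ t₀ →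
      |cgf id ν t - t ^ 2 / 2 * ∫ x, x ^ 2 ∂ν| ≤ K * |t| ^ 3 := by
  set M : ℝ := 25 * C / δ ^ 2
  have hM : 0 ≤ M := by positivity
  refine ⟨2 * M ^ 2 + 48 / δ ^ 3 * C, min (δ / 2) (1 / (2 * M + 1)), by positivity,
    fun ν h t ht => ?_⟩
  obtain ⟨htδ, htM⟩ := le_min_iff.1 ht
  rw [le_div_iff₀ (by positivity)] at htM
  have ht1 : |t| ≤ 1 := by nlinarith [abs_nonneg t]
  have hy : |mgf id ν t - 1| ≤ M * t ^ 2 := h.abs_mgf_sub_one_le hδ htδ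
  have hy_half : |mgf id ν t - 1| ≤ 1 / 2 := by
    refine hy.trans ?_
    rw [← sq_abs]
    nlinarith [mul_nonneg hM (abs_nonneg t), abs_nonneg t]
  have hlog : |cgf id ν t - (mgf id ν t - 1)| ≤ 2 * M ^ 2 * |t| ^ 3 := by
    calc |cgf id ν t - (mgf id ν t - 1)|
        ≤ 2 * |mgf id ν t - 1| ^ 2 := by
          simpa [cgf] using abs_log_one_add_sub_le hy_half
      _ ≤ 2 * (M * |t| ^ 2) ^ 2 := by rw [sq_abs t]; gcongr
      _ = 2 * M ^ 2 * |t| ^ 3 * |t| := by ring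
      _ ≤ 2 * M ^ 2 * |t| ^ 3 := mul_le_of_le_one_right (by positivity) ht1
  calc |cgf id ν t - t ^ 2 / 2 * ∫ x, x ^ 2 ∂ν|
      = |(cgf id ν t - (mgf id ν t - 1)) +
          (mgf id ν t - (1 + t ^ 2 / 2 * ∫ x, x ^ 2 ∂ν))| := by ring_nf
    _ ≤ 2 * M ^ 2 * |t| ^ 3 + 48 / δ ^ 3 * C * |t| ^ 3 :=
        (abs_add_le _ _).trans (add_le_add hlog (h.abs_mgf_sub_le hδ htδ))
    _ = (2 * M ^ 2 + 48 / δ ^ 3 * C) * |t| ^ 3 := by ring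

end IsCenteredStep

end CenteredStep

section Walk

/-- The law of a random walk started at `0` whose `k`-th step has law `ν k`. -/
noncomputable def walkLaw (ν : ℕ → Measure ℝ) : ℕ → Measure ℝ
  | 0 => Measure.dirac 0
  | n + 1 => walkLaw ν n ∗ ν n

theorem mgf_id_conv (μ ν : Measure ℝ) [SFinite μ] [SFinite ν] (t : ℝ) :
    mgf id (μ ∗ ν) t = mgf id μ t * mgf id ν t := by
  rw [Measure.conv, mgf_map (by fun_prop) (by fun_prop), mgf, mgf, mgf, ← integral_prod_mul]
  simp only [Function.comp_apply, id, mul_add, Real.exp_add]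

variable {ν : ℕ → Measure ℝ} {t : ℝ}

instance [∀ k, IsProbabilityMeasure (ν k)] (n : ℕ) : IsProbabilityMeasure (walkLaw ν n) := by
  induction n with
  | zero => exact Measure.dirac.isProbabilityMeasure
  | succ n ih => rw [walkLaw]; infer_instance

theorem mgf_walkLaw [∀ k, IsProbabilityMeasure (ν k)] (t : ℝ) (n : ℕ) :
    mgf id (walkLaw ν n) t = ∏ k ∈ Finset.range n, mgf id (ν k) t := by
  induction n with
  | zero => simp [walkLaw, mgf]
  | succ n ih => rw [walkLaw, mgf_id_conv, ih, Finset.prod_range_succ]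

theorem integrable_exp_mul_walkLaw [∀ k, IsProbabilityMeasure (ν k)]
    (h : ∀ k, Integrable (fun x => Real.exp (t * x)) (ν k)) (n : ℕ) :
    Integrable (fun x => Real.exp (t * x)) (walkLaw ν n) := by
  have hpos : 0 < mgf id (walkLaw ν n) t := by
    rw [mgf_walkLaw]
    exact Finset.prod_pos fun k _ => mgf_pos (h k)
  exact mgf_pos_iff.1 hpos

theorem cgf_walkLaw [∀ k, IsProbabilityMeasure (ν k)]
    (h : ∀ k, Integrable (fun x => Real.exp (t * x)) (ν k)) (n : ℕ) :
    cgf id (walkLaw ν n) t = ∑ k ∈ Finset.range n, cgf id (ν k) t := by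
  rw [cgf, mgf_walkLaw, Real.log_prod fun k _ => (mgf_pos (X := id) (h k)).ne']
  rfl

/-- With `b n = a n ^ 2 / n` and `u n = l * (a n / n)`, the errors in the expansions of the `n`
summands add up to the order `(b n)⁻¹ * n * |u n| ^ 3 = l ^ 2 * |u n|`. -/
theorem tendsto_inv_mul_sum_cgf {δ : ℝ} (hδ : 0 < δ) {C : ℝ≥0} (hν : ∀ k, IsCenteredStep δ C (ν k))
    {s : ℝ} (hs : Tendsto (fun n : ℕ => (n : ℝ)⁻¹ * ∑ k ∈ Finset.range n, ∫ x, x ^ 2 ∂ν k)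
      atTop (𝓝 s))
    {a : ℕ → ℝ} (ha : ∀ᶠ n in atTop, a n ≠ 0) (han : Tendsto (fun n => a n / n) atTop (𝓝 0))
    (l : ℝ) :
    Tendsto (fun n : ℕ => (a n ^ 2 / n)⁻¹ * ∑ k ∈ Finset.range n, cgf id (ν k) (l * (a n / n)))
      atTop (𝓝 (l ^ 2 * s / 2)) := by
  obtain ⟨K, t₀, ht₀, hK⟩ := IsCenteredStep.exists_abs_cgf_sub_le hδ C
  have hu : Tendsto (fun n => |l * (a n / n)|) atTop (𝓝 0) := by simpa using (han.const_mul l).abs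
  have herr : Tendsto (fun n : ℕ => (a n ^ 2 / n)⁻¹ * ∑ k ∈ Finset.range n,
      (cgf id (ν k) (l * (a n / n)) - (l * (a n / n)) ^ 2 / 2 * ∫ x, x ^ 2 ∂ν k))
      atTop (𝓝 0) := by
    have hbound := hu.const_mul (K * l ^ 2)
    rw [mul_zero] at hbound
    refine squeeze_zero_norm' ?_ hbound
    filter_upwards [ha, eventually_gt_atTop 0, hu.eventually_le_const ht₀] with n han0 hn hut
    have hsum : |∑ k ∈ Finset.range n, (cgf id (ν k) (l * (a n / n)) -
        (l * (a n / n)) ^ 2 / 2 * ∫ x, x ^ 2 ∂ν k)| ≤ n * (K * |l * (a n / n)| ^ 3) := by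
      refine (Finset.abs_sum_le_sum_abs _ _).trans ?_
      simpa using Finset.sum_le_card_nsmul (Finset.range n) _ _ fun k _ => hK _ (hν k) _ hut
    rw [norm_mul, Real.norm_eq_abs, Real.norm_eq_abs, abs_of_nonneg (by positivity)]
    refine (mul_le_mul_of_nonneg_left hsum (by positivity)).trans_eq ?_
    rw [pow_succ |l * (a n / n)|, sq_abs]
    generalize |l * (a n / n)| = r
    field_simp
  have hmain := (hs.const_mul (l ^ 2 / 2)).add herr
  rw [add_zero, div_mul_eq_mul_div] at hmain
  refine hmain.congr' ?_
  filter_upwards [ha, eventually_gt_atTop 0] with n han0 hn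
  rw [Finset.sum_sub_distrib, ← Finset.mul_sum]
  field_simp
  ring

theorem hasGaussianCgfLimit_walkLaw {δ : ℝ} (hδ : 0 < δ) {C : ℝ≥0}
    (hν : ∀ k, IsCenteredStep δ C (ν k)) {s : ℝ≥0}
    (hs : Tendsto (fun n : ℕ => (n : ℝ)⁻¹ * ∑ k ∈ Finset.range n, ∫ x, x ^ 2 ∂ν k) atTop (𝓝 s))
    {a : ℕ → ℝ} (ha : ∀ᶠ n in atTop, a n ≠ 0) (han : Tendsto (fun n => a n / n) atTop (𝓝 0)) :
    HasGaussianCgfLimit (fun n x => x / a n) (walkLaw ν) (fun n => a n ^ 2 / n) s := by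
  have (k : ℕ) : IsProbabilityMeasure (ν k) := (hν k).isProbabilityMeasure
  have hint (l : ℝ) : ∀ᶠ n in atTop, ∀ k,
      Integrable (fun x => Real.exp (l * (a n / n) * x)) (ν k) := by
    have hu : Tendsto (fun n => |l * (a n / n)|) atTop (𝓝 0) := by simpa using (han.const_mul l).abs
    filter_upwards [hu.eventually_le_const hδ] with n hn k using (hν k).integrable_exp_mul hn
  have harg (l : ℝ) : ∀ᶠ n : ℕ in atTop, ∀ x,
      a n ^ 2 / n * l * (x / a n) = l * (a n / n) * x := by
    filter_upwards [ha] with n hn x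
    field_simp
  refine ⟨fun l => ?_, fun l => (tendsto_inv_mul_sum_cgf hδ hν hs ha han l).congr' ?_⟩
  · filter_upwards [hint l, harg l] with n hn hx
    simpa only [hx] using integrable_exp_mul_walkLaw hn n
  · filter_upwards [hint l, harg l] with n hn hx
    rw [← cgf_walkLaw hn]
    simp only [cgf, mgf, hx, id]

theorem hasLDP_map_div_walkLaw {δ : ℝ} (hδ : 0 < δ) {C : ℝ≥0}
    (hν : ∀ k, IsCenteredStep δ C (ν k)) {s : ℝ≥0}
    (hs : Tendsto (fun n : ℕ => (n : ℝ)⁻¹ * ∑ k ∈ Finset.range n, ∫ x, x ^ 2 ∂ν k) atTop (𝓝 s))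
    {a : ℕ → ℝ} (han : Tendsto (fun n => a n / n) atTop (𝓝 0))
    (ha : Tendsto (fun n : ℕ => a n / √n) atTop atTop) :
    HasLDP (fun n => (walkLaw ν n).map fun x => x / a n) (fun n => a n ^ 2 / n) (rate s) := by
  have (k : ℕ) : IsProbabilityMeasure (ν k) := (hν k).isProbabilityMeasure
  have ha0 : ∀ᶠ n in atTop, a n ≠ 0 :=
    (ha.eventually_ne_atTop 0).mono fun n hn hn0 => hn (by rw [hn0, zero_div])
  have hspeed : Tendsto (fun n => a n ^ 2 / n) atTop atTop := by
    refine ((tendsto_pow_atTop two_ne_zero).comp ha).congr fun n => ?_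
    rw [Function.comp_apply, div_pow, Real.sq_sqrt n.cast_nonneg]
  exact (hasGaussianCgfLimit_walkLaw hδ hν hs ha0 han).hasLDP hspeed
    fun n => measurable_id.div_const _

end Walk

section InfiniteProduct

variable {ι : Type*} [DecidableEq ι] {X : ι → Type*}

theorem update_mem_pi_iff {s : Finset ι} {t : ∀ i, Set (X i)} {j : ι} {ω : ∀ i, X i} {x : X j} :
    Function.update ω j x ∈ Set.pi s t ↔ ω ∈ Set.pi (s.erase j) t ∧ (j ∈ s → x ∈ t j) := by
  simp only [Set.mem_pi, Finset.mem_coe, Finset.mem_erase]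
  refine ⟨fun h => ⟨fun i hi => ?_, fun hj => ?_⟩, fun ⟨h, hj⟩ i hi => ?_⟩
  · simpa [hi.1] using h i hi.2
  · simpa using h j hj
  · obtain rfl | hij := eq_or_ne i j
    · simpa using hj hi
    · simpa [hij] using h i ⟨hij, hi⟩

variable [∀ i, MeasurableSpace (X i)] (μ : ∀ i, Measure (X i)) [∀ i, IsProbabilityMeasure (μ i)]

theorem measurePreserving_update (j : ι) :
    MeasurePreserving (fun p : (∀ i, X i) × X j => Function.update p.1 j p.2)
      ((Measure.infinitePi μ).prod (μ j)) (Measure.infinitePi μ) := by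
  have hmeas : Measurable fun p : (∀ i, X i) × X j => Function.update p.1 j p.2 := by fun_prop
  refine ⟨hmeas, Measure.eq_infinitePi μ fun s t ht => ?_⟩
  have hpre : (fun p : (∀ i, X i) × X j => Function.update p.1 j p.2) ⁻¹' Set.pi s t =
      Set.pi (s.erase j) t ×ˢ {x | j ∈ s → x ∈ t j} := by
    ext p
    exact update_mem_pi_iff
  rw [Measure.map_apply hmeas (.pi s.countable_toSet fun i _ => ht i), hpre, Measure.prod_prod,
    Measure.infinitePi_pi μ fun i _ => ht i]
  by_cases hj : j ∈ s
  · simp [hj, Finset.prod_erase_mul]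
  · simp [hj]

theorem lintegral_infinitePi_update (j : ι) {f : (∀ i, X i) → ℝ≥0∞} (hf : Measurable f) :
    ∫⁻ ω, f ω ∂Measure.infinitePi μ =
      ∫⁻ ω, ∫⁻ x, f (Function.update ω j x) ∂μ j ∂Measure.infinitePi μ := by
  have h := measurePreserving_update μ j
  rw [← h.lintegral_comp hf]
  exact lintegral_prod _ (hf.comp h.measurable).aemeasurable

end InfiniteProduct

section ManyToOne

/-- The point process of the displacements of the children, as a kernel: a mark `(N, L)` is sent to
`∑_{i < N} δ_{L i}`. -/
noncomputable def offspring : Kernel Mark ℝ :=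
  Kernel.sum fun i : ℕ =>
    Kernel.piecewise (s := {x : Mark | i < x.1}) (measurableSet_lt measurable_const measurable_fst)
      (Kernel.deterministic (fun x : Mark => x.2 i) (by fun_prop)) 0

instance : IsSFiniteKernel offspring := by
  rw [offspring]
  infer_instance

theorem offspring_apply (x : Mark) :
    offspring x = ∑ i ∈ Finset.range x.1, Measure.dirac (x.2 i) := by
  ext A hA
  rw [offspring, Kernel.sum_apply' _ _ hA, Measure.finsetSum_apply,
    tsum_eq_sum (s := Finset.range x.1)]
  · refine Finset.sum_congr rfl fun i hi => ?_
    rw [Kernel.piecewise_apply, if_pos (by simpa using hi), Kernel.deterministic_apply]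
  · intro i hi
    rw [Kernel.piecewise_apply, if_neg (by simpa using hi)]
    rfl

theorem lintegral_offspring (x : Mark) (g : ℝ → ℝ≥0∞) :
    ∫⁻ y, g y ∂offspring x = ∑ i ∈ Finset.range x.1, g (x.2 i) := by
  rw [offspring_apply, lintegral_finsetSum_measure]
  simp only [lintegral_dirac]

theorem integral_offspring (x : Mark) (g : ℝ → ℝ) :
    ∫ y, g y ∂offspring x = ∑ i ∈ Finset.range x.1, g (x.2 i) := by
  rw [offspring_apply, integral_finsetSum_measure fun i _ => integrable_dirac (by simp)]
  simp only [integral_dirac]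

theorem position_update (ω : Marks) (v : Label) (x : Mark) {u : Label} (h : u.length ≤ v.length) :
    position (Function.update ω v x) u = position ω u := by
  induction u with
  | nil => rfl
  | cons i u ih =>
    rw [List.length_cons, Nat.succ_le_iff] at h
    rw [position, position, ih h.le, Function.update_of_ne (by rintro rfl; exact h.false)]

theorem inTree_update_iff (ω : Marks) (v : Label) (x : Mark) {u : Label}
    (h : u.length ≤ v.length) : InTree (Function.update ω v x) u ↔ InTree ω u := by
  induction u with
  | nil => rfl
  | cons i u ih =>
    rw [List.length_cons, Nat.succ_le_iff] at h
    rw [InTree, InTree, ih h.le, Function.update_of_ne (by rintro rfl; exact h.false)]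

theorem mem_generation_update_iff {n : ℕ} (ω : Marks) (u : Label) (x : Mark) :
    u ∈ generation n (Function.update ω u x) ↔ u ∈ generation n ω :=
  and_congr_left fun _ => inTree_update_iff ω u x le_rfl

theorem measurable_indicator_generation (n : ℕ) {f : Label → Marks → ℝ≥0∞}
    (hf : ∀ u, Measurable (f u)) (u : Label) :
    Measurable fun ω => (generation n ω).indicator (fun u => f u ω) u :=
  Measurable.indicator (s := {ω | u ∈ generation n ω}) (hf u)
    ((measurableSet_inTree u).inter (.const _))

theorem measurable_lintegral_offspring (u : Label) {g : ℝ → ℝ≥0∞} (hg : Measurable g) :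
    Measurable fun ω : Marks => ∫⁻ y, g (position ω u + y) ∂offspring (ω u) := by
  have hposition := measurable_position u
  exact Measurable.lintegral_kernel_prod_right'
    (κ := offspring.comap (fun ω : Marks => ω u) (measurable_pi_apply u))
    (f := fun p : Marks × ℝ => g (position p.1 u + p.2)) (by fun_prop)

theorem cons_mem_generation_succ_iff {n i : ℕ} {u : Label} {ω : Marks} :
    i :: u ∈ generation (n + 1) ω ↔ u ∈ generation n ω ∧ i < (ω u).1 := by
  simp only [generation, Set.mem_ofPred_eq, InTree, List.length_cons, Nat.add_right_cancel_iff]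
  tauto

theorem tsum_eq_tsum_cons {α : Type*} {F : List α → ℝ≥0∞} (h : F [] = 0) :
    ∑' u, F u = ∑' u, ∑' i, F (i :: u) := by
  have hinj : Function.Injective fun p : List α × α => p.2 :: p.1 := fun p q hpq => by
    obtain ⟨h₁, h₂⟩ := List.cons.inj hpq
    exact Prod.ext h₂ h₁
  rw [← hinj.tsum_eq, ENNReal.tsum_prod']
  rintro (_ | ⟨i, u⟩) hu
  · exact absurd h hu
  · exact ⟨(u, i), rfl⟩

theorem lintegral_Z (n : ℕ) (ω : Marks) (g : ℝ → ℝ≥0∞) :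
    ∫⁻ y, g y ∂Z n ω = ∑' u, (generation n ω).indicator (fun u => g (position ω u)) u := by
  rw [Z, lintegral_sum_measure, ← tsum_subtype]
  simp only [lintegral_dirac]

theorem lintegral_Z_succ (n : ℕ) (ω : Marks) (g : ℝ → ℝ≥0∞) :
    ∫⁻ y, g y ∂Z (n + 1) ω = ∑' u,
      (generation n ω).indicator (fun u => ∫⁻ y, g (position ω u + y) ∂offspring (ω u)) u := by
  have hnil : [] ∉ generation (n + 1) ω := fun h => n.succ_ne_zero h.2.symm
  rw [lintegral_Z, tsum_eq_tsum_cons (Set.indicator_of_notMem hnil _)]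
  refine tsum_congr fun u => ?_
  by_cases hu : u ∈ generation n ω
  · rw [Set.indicator_of_mem hu, lintegral_offspring, tsum_eq_sum (s := Finset.range (ω u).1)]
    · refine Finset.sum_congr rfl fun i hi => ?_
      rw [Set.indicator_of_mem (cons_mem_generation_succ_iff.2 ⟨hu, Finset.mem_range.1 hi⟩),
        position]
    · intro i hi
      rw [Set.indicator_of_notMem]
      exact fun h => hi (Finset.mem_range.2 (cons_mem_generation_succ_iff.1 h).2)
  · rw [Set.indicator_of_notMem hu, ENNReal.tsum_eq_zero]
    exact fun i => Set.indicator_of_notMem (fun h => hu (cons_mem_generation_succ_iff.1 h).1) _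

variable {Θ : Type*} [MeasurableSpace Θ] (η : Kernel Θ Mark)

/-- The mean measure `A ↦ E ∑_{i < N} 1_A(L i)` of the displacements when the mark has law `η θ`. -/
noncomputable def stepIntensity : Kernel Θ ℝ := offspring ∘ₖ η

instance [IsSFiniteKernel η] : IsSFiniteKernel (stepIntensity η) := by
  rw [stepIntensity]
  infer_instance

variable [IsMarkovKernel η]

theorem quenchedSum_eq_lintegral_stepIntensity (ξ : ℕ → Θ) (n : ℕ) {f : ℝ → ℝ≥0∞}
    (hf : Measurable f) : quenchedSum η ξ n f = ∫⁻ x, f x ∂stepIntensity η (ξ n) := by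
  have h := measurePreserving_eval_infinitePi (fun u : Label => η (ξ u.length))
    (List.replicate n 0)
  rw [List.length_replicate] at h
  rw [stepIntensity, Kernel.lintegral_comp _ _ _ hf, ← h.lintegral_comp hf.lintegral_kernel]
  simp only [lintegral_offspring]
  rfl

/-- Whether `u` belongs to the tree and where it is located depends only on the marks of its strict
ancestors, so the mark of `u` itself may be resampled. -/
theorem lintegral_generation_offspring (ξ : ℕ → Θ) (n : ℕ) (u : Label) {g : ℝ → ℝ≥0∞}
    (hg : Measurable g) :
    ∫⁻ ω, (generation n ω).indicator (fun u => ∫⁻ y, g (position ω u + y) ∂offspring (ω u)) u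
        ∂quenchedLaw η ξ =
      ∫⁻ ω, (generation n ω).indicator
        (fun u => ∫⁻ y, g (position ω u + y) ∂stepIntensity η (ξ n)) u ∂quenchedLaw η ξ := by
  have hmeas := measurable_indicator_generation n (fun u => measurable_lintegral_offspring u hg) u
  rw [quenchedLaw, lintegral_infinitePi_update _ u hmeas]
  refine lintegral_congr fun ω => ?_
  by_cases hu : u ∈ generation n ω
  · simp only [Set.indicator_of_mem ((mem_generation_update_iff ω u _).2 hu),
      Set.indicator_of_mem hu, position_update _ _ _ le_rfl, Function.update_self]
    rw [stepIntensity, Kernel.lintegral_comp _ _ _ (by fun_prop), hu.2]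
  · simp only [Set.indicator_of_notMem (mt (mem_generation_update_iff ω u _).1 hu),
      Set.indicator_of_notMem hu, lintegral_zero]

theorem meanZ_zero (ξ : ℕ → Θ) : meanZ η ξ 0 = Measure.dirac 0 := by
  have hZ (ω : Marks) : Z 0 ω = Measure.dirac 0 := by
    refine Measure.ext_of_lintegral _ fun g _ => ?_
    rw [lintegral_Z, tsum_eq_single []]
    · rw [Set.indicator_of_mem (show [] ∈ generation 0 ω from ⟨trivial, rfl⟩), lintegral_dirac]
      rfl
    · exact fun u hu => Set.indicator_of_notMem (fun h => hu (List.eq_nil_of_length_eq_zero h.2)) _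
  have : IsProbabilityMeasure (quenchedLaw η ξ) := by
    rw [quenchedLaw]
    infer_instance
  simp [meanZ, funext hZ]

theorem lintegral_meanZ (ξ : ℕ → Θ) (n : ℕ) {g : ℝ → ℝ≥0∞} (hg : Measurable g) :
    ∫⁻ y, g y ∂meanZ η ξ n = ∫⁻ ω, ∫⁻ y, g y ∂Z n ω ∂quenchedLaw η ξ :=
  Measure.lintegral_bind (measurable_Z n).aemeasurable hg.aemeasurable

theorem meanZ_succ (ξ : ℕ → Θ) (n : ℕ) :
    meanZ η ξ (n + 1) = meanZ η ξ n ∗ stepIntensity η (ξ n) := by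
  refine Measure.ext_of_lintegral _ fun g hg => ?_
  have hstep : Measurable fun x => ∫⁻ y, g (x + y) ∂stepIntensity η (ξ n) :=
    Measurable.lintegral_prod_right (by fun_prop)
  rw [Measure.lintegral_conv hg, lintegral_meanZ η ξ n hstep, lintegral_meanZ η ξ (n + 1) hg]
  simp only [lintegral_Z_succ, lintegral_Z]
  rw [lintegral_tsum, lintegral_tsum]
  · exact tsum_congr fun u => lintegral_generation_offspring η ξ n u hg
  · exact fun u => (measurable_indicator_generation n
      (fun u => hstep.comp (measurable_position u)) u).aemeasurable
  · exact fun u => (measurable_indicator_generation n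
      (fun u => measurable_lintegral_offspring u hg) u).aemeasurable

theorem meanZ_eq_walkLaw (ξ : ℕ → Θ) (n : ℕ) :
    meanZ η ξ n = walkLaw (fun k => stepIntensity η (ξ k)) n := by
  induction n with
  | zero => exact meanZ_zero η ξ
  | succ n ih => rw [meanZ_succ, ih, walkLaw]

end ManyToOne

section Normalization

theorem walkLaw_smul (μ : ℕ → Measure ℝ) [∀ k, SFinite (μ k)] (c : ℕ → ℝ≥0∞) (n : ℕ) :
    walkLaw (fun k => c k • μ k) n = (∏ k ∈ Finset.range n, c k) • walkLaw μ n := by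
  induction n with
  | zero => simp [walkLaw]
  | succ n ih =>
    rw [walkLaw, ih, Measure.conv_smul_left, Measure.conv_smul_right, smul_smul, walkLaw,
      Finset.prod_range_succ]

variable {Θ : Type*} [MeasurableSpace Θ] (η : Kernel Θ Mark)

/-- The probability measure proportional to `stepIntensity η θ`: the step distribution of the random
walk which has the law of the normalized mean measures. -/
noncomputable def stepLaw (θ : Θ) : Measure ℝ :=
  (stepIntensity η θ Set.univ)⁻¹ • stepIntensity η θ

theorem isProbabilityMeasure_stepLaw {θ : Θ} (h₀ : stepIntensity η θ Set.univ ≠ 0)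
    (h : stepIntensity η θ Set.univ ≠ ∞) : IsProbabilityMeasure (stepLaw η θ) := by
  constructor
  rw [stepLaw, Measure.smul_apply, smul_eq_mul, ENNReal.inv_mul_cancel h₀ h]

theorem measurable_integral_stepLaw [IsSFiniteKernel η] {f : ℝ → ℝ} (hf : Measurable f) :
    Measurable fun θ => ∫ x, f x ∂stepLaw η θ := by
  simp only [stepLaw, integral_smul_measure]
  exact ((stepIntensity η).measurable_coe .univ).inv.ennreal_toReal.smul
    hf.stronglyMeasurable.integral_kernel.measurable

variable [IsMarkovKernel η] (ξ : ℕ → Θ) (n : ℕ)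

theorem walkLaw_stepLaw [∀ k, IsProbabilityMeasure (stepLaw η (ξ k))] :
    walkLaw (fun k => stepLaw η (ξ k)) n = (meanZ η ξ n Set.univ)⁻¹ • meanZ η ξ n := by
  have hsmul : walkLaw (fun k => stepLaw η (ξ k)) n =
      (∏ k ∈ Finset.range n, (stepIntensity η (ξ k) Set.univ)⁻¹) • meanZ η ξ n := by
    rw [meanZ_eq_walkLaw]
    exact walkLaw_smul _ _ n
  have hmass := measure_univ (μ := walkLaw (fun k => stepLaw η (ξ k)) n)
  rw [hsmul, Measure.smul_apply, smul_eq_mul] at hmass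
  rw [hsmul, ENNReal.eq_inv_of_mul_eq_one_left hmass]

theorem normalizedMean_eq_map_walkLaw [∀ k, IsProbabilityMeasure (stepLaw η (ξ k))] (c : ℝ) :
    normalizedMean η ξ n c = (walkLaw (fun k => stepLaw η (ξ k)) n).map fun x => x / c := by
  rw [normalizedMean, walkLaw_stepLaw, Measure.map_smul]

theorem m_zero_eq_stepIntensity_univ : m η ξ n 0 = stepIntensity η (ξ n) Set.univ := by
  rw [m, quenchedSum_eq_lintegral_stepIntensity η ξ n (by fun_prop)]
  simp

theorem inv_m_mul_quenchedSum {f : ℝ → ℝ≥0∞} (hf : Measurable f) :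
    (m η ξ n 0)⁻¹ * quenchedSum η ξ n f = ∫⁻ x, f x ∂stepLaw η (ξ n) := by
  rw [m_zero_eq_stepIntensity_univ, quenchedSum_eq_lintegral_stepIntensity η ξ n hf, stepLaw,
    lintegral_smul_measure, smul_eq_mul]

theorem integral_quenchedLaw_root (h : Integrable (fun x => x) (stepIntensity η (ξ 0))) :
    ∫ ω, ∑ i ∈ Finset.range (ω []).1, (ω []).2 i ∂quenchedLaw η ξ =
      ∫ x, x ∂stepIntensity η (ξ 0) := by
  have hroot : (quenchedLaw η ξ).map (fun ω => ω []) = η (ξ 0) :=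
    (measurePreserving_eval_infinitePi (fun u : Label => η (ξ u.length)) []).map_eq
  have hmeas : AEStronglyMeasurable (fun x : Mark => ∫ y, y ∂offspring x) (η (ξ 0)) :=
    stronglyMeasurable_id.integral_kernel.aestronglyMeasurable
  rw [stepIntensity, Kernel.integral_comp h, ← hroot,
    integral_map (measurable_pi_apply ([] : Label)).aemeasurable (hroot ▸ hmeas)]
  simp only [integral_offspring]

end Normalization

section Environment

theorem iterate_shift {Θ : Type*} (ξ : ℕ → Θ) (k : ℕ) : shift^[k] ξ = fun j => ξ (j + k) := by
  induction k with
  | zero => rfl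
  | succ k ih =>
    rw [Function.iterate_succ_apply', ih]
    funext j
    simp only [shift, add_right_comm, add_assoc]

variable {Θ : Type*} [MeasurableSpace Θ] {η : Kernel Θ Mark} [IsMarkovKernel η]
  {τ : Measure (ℕ → Θ)} {δ : ℝ} {C : ℝ≥0}

theorem ae_forall_of_ae_zero (hτ : MeasurePreserving shift τ τ) {P : Θ → Prop}
    (h : ∀ᵐ ξ ∂τ, P (ξ 0)) : ∀ᵐ ξ ∂τ, ∀ k, P (ξ k) := by
  refine ae_all_iff.2 fun k => ?_
  filter_upwards [(hτ.iterate k).quasiMeasurePreserving.ae h] with ξ hξ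
  simpa only [iterate_shift, zero_add] using hξ

theorem isCenteredStep_stepLaw (hδ : 0 < δ) {ξ : ℕ → Θ} (hpos : 0 < m η ξ 0 0)
    (hlt : m η ξ 0 0 < ∞)
    (hexp : (m η ξ 0 0)⁻¹ * quenchedSum η ξ 0 (fun x => ENNReal.ofReal (Real.exp (δ * |x|))) ≤ C)
    (hmean : ∫ ω, ∑ i ∈ Finset.range (ω []).1, (ω []).2 i ∂quenchedLaw η ξ = 0) :
    IsCenteredStep δ C (stepLaw η (ξ 0)) := by
  rw [inv_m_mul_quenchedSum η ξ 0 (by fun_prop)] at hexp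
  rw [m_zero_eq_stepIntensity_univ] at hpos hlt
  have hint : Integrable (fun x => x) (stepIntensity η (ξ 0)) := by
    have h := integrable_pow_of_integrable_exp_abs hδ
      (integrable_exp_abs_of_lintegral_ne_top (hexp.trans_lt ENNReal.coe_lt_top).ne) 1
    simp only [pow_one, stepLaw] at h
    exact (integrable_smul_measure (ENNReal.inv_ne_zero.2 hlt.ne)
      (ENNReal.inv_ne_top.2 hpos.ne')).1 h
  refine ⟨isProbabilityMeasure_stepLaw η hpos.ne' hlt.ne, hexp, ?_⟩
  rw [stepLaw, integral_smul_measure, ← integral_quenchedLaw_root η ξ hint, hmean, smul_zero]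

theorem ae_isCenteredStep_stepLaw (hδ : 0 < δ)
    (hpi : ∀ᵐ ξ ∂τ, 0 < m η ξ 0 0 ∧ m η ξ 0 0 < ∞)
    (hexp : essSup (fun ξ => (m η ξ 0 0)⁻¹ *
      quenchedSum η ξ 0 (fun x => ENNReal.ofReal (Real.exp (δ * |x|)))) τ < ∞)
    (hmean : ∀ᵐ ξ ∂τ, ∫ ω, ∑ i ∈ Finset.range (ω []).1, (ω []).2 i ∂quenchedLaw η ξ = 0) :
    ∃ C : ℝ≥0, ∀ᵐ ξ ∂τ, IsCenteredStep δ C (stepLaw η (ξ 0)) := by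
  obtain ⟨C, hC⟩ := WithTop.ne_top_iff_exists.1 hexp.ne
  refine ⟨C, ?_⟩
  filter_upwards [hpi, hmean, ENNReal.ae_le_essSup (μ := τ) _] with ξ hpi hmean hle
  exact isCenteredStep_stepLaw hδ hpi.1 hpi.2 (hle.trans_eq hC.symm) hmean

theorem integrable_variance_stepLaw [IsFiniteMeasure τ] (hδ : 0 < δ)
    (h : ∀ᵐ ξ ∂τ, IsCenteredStep δ C (stepLaw η (ξ 0))) :
    Integrable (fun ξ => ∫ x, x ^ 2 ∂stepLaw η (ξ 0)) τ := by
  have hmeas := (measurable_integral_stepLaw η (measurable_id.pow_const 2)).comp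
    (measurable_pi_apply (X := fun _ : ℕ => Θ) 0)
  refine (integrable_const (2 / δ ^ 2 * C : ℝ)).mono' hmeas.aestronglyMeasurable ?_
  filter_upwards [h] with ξ hξ
  rw [Real.norm_of_nonneg (integral_nonneg fun x => sq_nonneg x)]
  exact hξ.integral_sq_le hδ

theorem sigmaSq_eq_ofReal_integral [IsFiniteMeasure τ] (hδ : 0 < δ)
    (h : ∀ᵐ ξ ∂τ, IsCenteredStep δ C (stepLaw η (ξ 0))) :
    sigmaSq η τ = ENNReal.ofReal (∫ ξ, ∫ x, x ^ 2 ∂stepLaw η (ξ 0) ∂τ) := by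
  rw [sigmaSq, ofReal_integral_eq_lintegral_ofReal (integrable_variance_stepLaw hδ h)
    (ae_of_all _ fun ξ => integral_nonneg fun x => sq_nonneg x)]
  refine lintegral_congr_ae ?_
  filter_upwards [h] with ξ hξ
  rw [inv_m_mul_quenchedSum η ξ 0 (by fun_prop),
    ofReal_integral_eq_lintegral_ofReal (hξ.integrable_pow hδ 2) (ae_of_all _ fun x => sq_nonneg x)]

theorem ae_tendsto_inv_mul_sum_variance [IsProbabilityMeasure τ] (hτ : Ergodic shift τ)
    (hδ : 0 < δ) (h : ∀ᵐ ξ ∂τ, IsCenteredStep δ C (stepLaw η (ξ 0))) :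
    ∀ᵐ ξ ∂τ, Tendsto (fun n : ℕ => (n : ℝ)⁻¹ *
      ∑ k ∈ Finset.range n, ∫ x, x ^ 2 ∂stepLaw η (ξ k)) atTop (𝓝 (sigmaSq η τ).toReal) := by
  have hmeas := (measurable_integral_stepLaw η (measurable_id.pow_const 2)).comp
    (measurable_pi_apply (X := fun _ : ℕ => Θ) 0)
  rw [sigmaSq_eq_ofReal_integral hδ h, ENNReal.toReal_ofReal
    (integral_nonneg fun ξ => integral_nonneg fun x => sq_nonneg x)]
  filter_upwards [ae_tendsto_birkhoffAverage hτ hmeas (integrable_variance_stepLaw hδ h)]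
    with ξ hξ
  simpa only [birkhoffAverage, birkhoffSum, smul_eq_mul, iterate_shift, zero_add,
    Function.comp_apply, id] using hξ

theorem hasLDP_normalizedMean (hδ : 0 < δ) {ξ : ℕ → Θ}
    (hξ : ∀ k, IsCenteredStep δ C (stepLaw η (ξ k))) {s : ℝ≥0∞} (hs : s ≠ ∞)
    (hvar : Tendsto (fun n : ℕ => (n : ℝ)⁻¹ *
      ∑ k ∈ Finset.range n, ∫ x, x ^ 2 ∂stepLaw η (ξ k)) atTop (𝓝 s.toReal))
    {a : ℕ → ℝ} (han : Tendsto (fun n => a n / n) atTop (𝓝 0))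
    (ha : Tendsto (fun n : ℕ => a n / √n) atTop atTop) :
    HasLDP (fun n => normalizedMean η ξ n (a n)) (fun n => a n ^ 2 / n) (rate s) := by
  have (k : ℕ) : IsProbabilityMeasure (stepLaw η (ξ k)) := (hξ k).isProbabilityMeasure
  lift s to ℝ≥0 using hs
  simp only [normalizedMean_eq_map_walkLaw]
  exact hasLDP_map_div_walkLaw hδ hξ hvar han ha

end Environment

end BRWRE

theorem mainTheorem7 {Θ : Type*} [MeasurableSpace Θ]
    (τ : Measure (ℕ → Θ)) [IsProbabilityMeasure τ] (hτ : Ergodic BRWRE.shift τ)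
    (η : Kernel Θ BRWRE.Mark) [IsMarkovKernel η]
    (hpi : ∀ᵐ ξ ∂τ, 0 < BRWRE.m η ξ 0 0 ∧ BRWRE.m η ξ 0 0 < ∞)
    (δ : ℝ) (hδ : 0 < δ)
    (hexp : essSup (fun ξ => (BRWRE.m η ξ 0 0)⁻¹ *
      BRWRE.quenchedSum η ξ 0 (fun x => ENNReal.ofReal (Real.exp (δ * |x|)))) τ < ∞)
    (hmean : ∀ᵐ ξ ∂τ,
      ∫ ω, ∑ i ∈ Finset.range (ω []).1, (ω []).2 i ∂(BRWRE.quenchedLaw η ξ) = 0)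
    (a : ℕ → ℝ) (ha : ∀ n, 0 < a n)
    (ha_n : Tendsto (fun n : ℕ => a n / (n : ℝ)) atTop (𝓝 0))
    (ha_sqrt : Tendsto (fun n : ℕ => a n / Real.sqrt (n : ℝ)) atTop atTop) :
    BRWRE.sigmaSq η τ < ∞ ∧
    ∀ᵐ ξ ∂τ,
      (∀ n, IsProbabilityMeasure (BRWRE.normalizedMean η ξ n (a n))) ∧
      ∀ A : Set ℝ, MeasurableSet A →
        -((⨅ x ∈ interior A, BRWRE.rate (BRWRE.sigmaSq η τ) x : ℝ≥0∞) : EReal) ≤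
          liminf (fun n : ℕ => (((n : ℝ) / a n ^ 2 : ℝ) : EReal) *
            ENNReal.log (BRWRE.normalizedMean η ξ n (a n) A)) atTop ∧
        liminf (fun n : ℕ => (((n : ℝ) / a n ^ 2 : ℝ) : EReal) *
            ENNReal.log (BRWRE.normalizedMean η ξ n (a n) A)) atTop ≤
          limsup (fun n : ℕ => (((n : ℝ) / a n ^ 2 : ℝ) : EReal) *
            ENNReal.log (BRWRE.normalizedMean η ξ n (a n) A)) atTop ∧
        limsup (fun n : ℕ => (((n : ℝ) / a n ^ 2 : ℝ) : EReal) *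
            ENNReal.log (BRWRE.normalizedMean η ξ n (a n) A)) atTop ≤
          -((⨅ x ∈ closure A, BRWRE.rate (BRWRE.sigmaSq η τ) x : ℝ≥0∞) : EReal) := by
  obtain ⟨C, hstep⟩ := BRWRE.ae_isCenteredStep_stepLaw hδ hpi hexp hmean
  have hσ : BRWRE.sigmaSq η τ < ∞ := by
    rw [BRWRE.sigmaSq_eq_ofReal_integral hδ hstep]
    exact ENNReal.ofReal_lt_top
  refine ⟨hσ, ?_⟩
  filter_upwards [BRWRE.ae_forall_of_ae_zero hτ.toMeasurePreserving
      (P := fun θ => BRWRE.IsCenteredStep δ C (BRWRE.stepLaw η θ)) hstep,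
    BRWRE.ae_tendsto_inv_mul_sum_variance hτ hδ hstep] with ξ hξ hvar
  have (k : ℕ) : IsProbabilityMeasure (BRWRE.stepLaw η (ξ k)) := (hξ k).isProbabilityMeasure
  have hLDP := BRWRE.hasLDP_normalizedMean hδ hξ hσ.ne hvar ha_n ha_sqrt
  have hspeed : ∀ᶠ n : ℕ in atTop, 0 ≤ a n ^ 2 / n := .of_forall fun n => by positivity
  refine ⟨fun n => ?_, fun A _ => ?_⟩
  · rw [BRWRE.normalizedMean_eq_map_walkLaw]
    exact Measure.isProbabilityMeasure_map (by fun_prop)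
  · simp only [← inv_div (a _ ^ 2)]
    exact ⟨hLDP.le_liminf_interior hspeed A, liminf_le_limsup, hLDP.limsup_le_closure hspeed A⟩
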